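/- Let $\sigma_1,\dots,\sigma_d$ be real numbers (for instance the singular values of a matrix), $k\ge 0$ an integer, and $\beta_l=(\sigma_l^{2k})^2$. Fix $i$ with $\beta_i>0$ and $\sum_{l\ne i}\beta_l>0$. For $y\sim\mathcal N(0,I_d)$ put $$\lambda_i(k)=\mathbb E\,\frac{(y_i\sigma_i^{2k})^2}{\sum_{l=1}^{d}(y_l\sigma_l^{2k})^2},\qquad u=y_i^2,\qquad v_i=\sum_{l\ne i}\frac{\beta_l}{\beta_i}y_l^2,$$ $$\alpha_i=\frac12\,\frac{(\sum_{l\ne i}\beta_l)^2}{\sum_{l\ne i}\beta_l^2},\qquad \gamma_i=\frac1{\beta_i}\,\frac{\sum_{l\ne i}\beta_l^2}{\sum_{l\ne i}\beta_l},$$ and let $\mathcal G(a,\theta)$ denote the Gamma distribution with shape $a$ and scale $\theta$. Then: (1) $\alpha_i,\gamma_i>0$ and, exactly, $\lambda_i(k)=\mathbb E\frac{\beta_iy_i^2}{\beta_iy_i^2+\sum_{l\ne i}\beta_ly_l^2}=\mathbb E\frac{u}{u+v_i}$, where $u\sim\mathcal G(\tfrac12,2)$ is independent of $v_i$; moreover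 $v_i$ has finite second moment and the same mean and variance as $\mathcal G(\alpha_i,2\gamma_i)$. (2) Replace $v_i$ by its moment-matching Gamma surrogate: let $U\sim\mathcal G(\tfrac12,2)$ and $V\sim\mathcal G(\alpha_i,2\gamma_i)$ be independent random variables on any probability space. Then $z=U/(U+V)$ has the probability density $$x_i^\bullet(z)=\frac{\gamma_i}{(1-(1-\gamma_i)z)^2}\;\mathcal B\!\Big(\frac{\gamma_i z}{1-(1-\gamma_i)z};\tfrac12,\alpha_i\Big),$$ where $\mathcal B(\,\cdot\,;\tfrac12,\alpha_i)$ is the density of the Beta$(\tfrac12,\alpha_i)$ distribution (zero outside $(0,1)$); $x_i^\bullet$ is nonnegative with support $[0,1]$, and $$\mathbb E\frac{U}{U+V}=\int_0^1 z\,x_i^\bullet(z)\,dz=\gamma_i^{1/2}\,\frac{\Gamma(\frac32)\Gamma(\frac12+\alpha_i)}{\Gamma(\frac12)\Gamma(\frac32+\alpha_i)}\;{}_2F_1\!\big(\tfrac32,\tfrac12+\alpha_i;\tfrac32+\alpha_i;1-\gamma_i\big),$$ where ${}_2F_1$ is Gauss's hypergeometric function, i.e. the analytic continuation of the hypergeometric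 series to $\mathbb C\setminus[1,\infty)$. (3) In particular, whenever $v_i$ itself has the law $\mathcal G(\alpha_i,2\gamma_i)$, the number $\lambda_i(k)$ equals the expression in (2). -/

import Mathlib

open MeasureTheory ProbabilityTheory Set

noncomputable section

namespace SpectralAug

/-- The standard normal law `N(0, I)` on `ℝ^d`: i.i.d. standard normal coordinates. -/
def stdNormal (d : ℕ) : Measure (Fin d → ℝ) := Measure.pi fun _ => gaussianReal 0 1

/-- The Gamma distribution with shape `a` and *scale* `θ` (Mathlib's is parametrized by the
rate `1 / θ`). -/
def gammaScale (a θ : ℝ) : Measure ℝ := gammaMeasure a θ⁻¹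

/-- `βᵢ = (σᵢ^{2k})²`. -/
def beta {d : ℕ} (σ : Fin d → ℝ) (k : ℕ) (i : Fin d) : ℝ := (σ i ^ (2 * k)) ^ 2

/-- `λᵢ(k) = E_{y ∼ N(0, I)} [(yᵢ σᵢ^{2k})² / ∑ₗ (yₗ σₗ^{2k})²]`. -/
def lam {d : ℕ} (σ : Fin d → ℝ) (k : ℕ) (i : Fin d) : ℝ :=
  ∫ y, (y i * σ i ^ (2 * k)) ^ 2 / ∑ l, (y l * σ l ^ (2 * k)) ^ 2 ∂stdNormal d

/-- `u = yᵢ²`. -/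
def uVar {d : ℕ} (i : Fin d) (y : Fin d → ℝ) : ℝ := y i ^ 2

/-- `vᵢ = ∑_{l ≠ i} (βₗ / βᵢ) yₗ²`. -/
def vVar {d : ℕ} (σ : Fin d → ℝ) (k : ℕ) (i : Fin d) (y : Fin d → ℝ) : ℝ :=
  ∑ l ∈ Finset.univ.erase i, beta σ k l / beta σ k i * y l ^ 2

/-- `αᵢ = (1/2) (∑_{l ≠ i} βₗ)² / ∑_{l ≠ i} βₗ²`. -/
def alpha {d : ℕ} (σ : Fin d → ℝ) (k : ℕ) (i : Fin d) : ℝ :=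
  1 / 2 * ((∑ l ∈ Finset.univ.erase i, beta σ k l) ^ 2 /
    ∑ l ∈ Finset.univ.erase i, beta σ k l ^ 2)

/-- `γᵢ = (1/βᵢ) (∑_{l ≠ i} βₗ²) / ∑_{l ≠ i} βₗ`. -/
def gam {d : ℕ} (σ : Fin d → ℝ) (k : ℕ) (i : Fin d) : ℝ :=
  1 / beta σ k i * ((∑ l ∈ Finset.univ.erase i, beta σ k l ^ 2) /
    ∑ l ∈ Finset.univ.erase i, beta σ k l)

/-- The density
`x•(z) = γ / (1 - (1 - γ) z)² * B(γ z / (1 - (1 - γ) z); 1/2, α)`,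
where `B( · ; 1/2, α)` is the density of the Beta distribution (zero outside `(0, 1)`). -/
def xPDF (α γ z : ℝ) : ℝ :=
  γ / (1 - (1 - γ) * z) ^ 2 * betaPDFReal (1 / 2) α (γ * z / (1 - (1 - γ) * z))

/-- The plane cut along `[1, ∞)`. -/
def cutPlane : Set ℂ := {z | 1 - z ∈ Complex.slitPlane}

/-- `F` is holomorphic on `ℂ \ [1, ∞)` and is the sum of Gauss's hypergeometric series
`∑ₙ (a)ₙ (b)ₙ / (c)ₙ * zⁿ / n!` on the unit disc. -/
structure IsGaussHypergeometric (a b c : ℂ) (F : ℂ → ℂ) : Prop where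
  differentiableOn : DifferentiableOn ℂ F cutPlane
  eq_series : ∀ z : ℂ, ‖z‖ < 1 → F z = ₂F₁ a b c z

open Classical in
/-- Gauss's hypergeometric function `₂F₁(a, b; c; z)` on `ℂ \ [1, ∞)`: the analytic continuation
of the hypergeometric series. (If there were no continuation, the value would be `0`; values on
the cut are not meaningful.) -/
def hyp2F1 (a b c : ℂ) : ℂ → ℂ :=
  if h : ∃ F, IsGaussHypergeometric a b c F then h.choose else 0

/-- The continuation is unique, so `hyp2F1` does not depend on a choice on `ℂ \ [1, ∞)`. -/
theorem IsGaussHypergeometric.eqOn {a b c : ℂ} {F : ℂ → ℂ}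
    (hF : IsGaussHypergeometric a b c F) : EqOn (hyp2F1 a b c) F cutPlane := by
  have hex : ∃ F, IsGaussHypergeometric a b c F := ⟨F, hF⟩
  have hG : IsGaussHypergeometric a b c (hyp2F1 a b c) := by
    rw [hyp2F1, dif_pos hex]
    exact hex.choose_spec
  have hopen : IsOpen cutPlane :=
    Complex.isOpen_slitPlane.preimage (continuous_const.sub continuous_id)
  have hstar : StarConvex ℝ (0 : ℂ) cutPlane := by
    intro z hz s t hs ht hst
    have h := Complex.starConvex_one_slitPlane hz hs ht hst
    have e : (1 : ℂ) - (s • (0 : ℂ) + t • z) = s • (1 : ℂ) + t • (1 - z) := by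
      have hst' : (s : ℂ) + t = 1 := by exact_mod_cast hst
      simp only [Complex.real_smul]
      linear_combination -hst'
    change (1 : ℂ) - (s • (0 : ℂ) + t • z) ∈ Complex.slitPlane
    rw [e]
    exact h
  have h0 : (0 : ℂ) ∈ cutPlane := by simp [cutPlane]
  refine AnalyticOnNhd.eqOn_of_preconnected_of_eventuallyEq
    (hG.differentiableOn.analyticOnNhd hopen) (hF.differentiableOn.analyticOnNhd hopen)
    (hstar.isPathConnected h0).isConnected.isPreconnected h0 ?_
  filter_upwards [Metric.ball_mem_nhds (0 : ℂ) one_pos] with z hz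
  have hz' : ‖z‖ < 1 := by simpa using hz
  rw [hG.eq_series z hz', hF.eq_series z hz']

end SpectralAug

end

namespace SpectralAug

/-! Dividing numerator and denominator by `βᵢ` gives `λᵢ = E[u / (u + vᵢ)]`. The square of a
standard normal variable is Gamma(1/2, scale 2) (`map_sq_gaussianReal`), and `vᵢ` involves only the
other coordinates, so it is independent of `u`. As a weighted sum of independent squares it has mean
`∑ βₗ/βᵢ` and variance `2 ∑ (βₗ/βᵢ)²`; `αᵢ` and `2γᵢ` are the shape and scale solving `αθ = mean`,
`αθ² = variance`.

For independent Gamma variables, substitute `v = u(1 - z)/z` at fixed `u`, exchange the integrals,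
and integrate out `u`, which leaves a Gamma density of shape `1/2 + α` times `xPDF`
(`map_div_add_gammaMeasure`).

The function `z * xPDF α γ z` is a constant times the Beta(3/2, α) density times `(1 - (1 - γ) z) ^
(-(1/2 + α))`, so the mean is Euler's integral at `1 - γ`. That integral is holomorphic on the cut
plane and equals the hypergeometric series on the disc (`isGaussHypergeometric_eulerIntegral`);
uniqueness of the continuation identifies it with `hyp2F1`, also for `γ ≥ 2`, where `1 - γ` lies
outside the open unit disc. -/

/-! ### Moments of Beta and Gamma laws -/

lemma measurable_betaPDF (b β : ℝ) : Measurable (betaPDF b β) :=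
  (measurable_betaPDFReal b β).ennreal_ofReal

lemma measurable_gammaPDF (a r : ℝ) : Measurable (gammaPDF a r) :=
  (measurable_gammaPDFReal a r).ennreal_ofReal

lemma ae_betaMeasure_mem_Ioo (b β : ℝ) : ∀ᵐ t ∂betaMeasure b β, t ∈ Ioo (0 : ℝ) 1 := by
  rw [betaMeasure, ae_withDensity_iff (measurable_betaPDF b β)]
  refine ae_of_all _ fun t ht => ?_
  by_contra h
  refine ht ?_
  rw [betaPDF, betaPDFReal, if_neg (by simpa using h), ENNReal.ofReal_zero]

lemma integral_betaMeasure {E : Type*} [NormedAddCommGroup E] [NormedSpace ℝ E]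
    {b β : ℝ} (hb : 0 < b) (hβ : 0 < β) (f : ℝ → E) :
    ∫ t, f t ∂betaMeasure b β = ∫ t, betaPDFReal b β t • f t := by
  have hnn : ∀ t, 0 ≤ betaPDFReal b β t := fun t => by
    by_cases h : 0 < t ∧ t < 1
    · exact (betaPDFReal_pos h.1 h.2 hb hβ).le
    · rw [betaPDFReal, if_neg h]
  rw [betaMeasure, integral_withDensity_eq_integral_toReal_smul (measurable_betaPDF b β)
    (ae_of_all _ fun _ => ENNReal.ofReal_lt_top)]
  simp only [betaPDF, ENNReal.toReal_ofReal (hnn _)]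

lemma integral_betaPDFReal {b β : ℝ} (hb : 0 < b) (hβ : 0 < β) :
    ∫ t, betaPDFReal b β t = 1 := by
  have := isProbabilityMeasureBeta hb hβ
  simpa using (integral_betaMeasure hb hβ (fun _ => (1 : ℝ))).symm

/-- A factor `t ^ n` only shifts the first parameter, so every moment is a quotient of normalizing
constants. -/
lemma betaPDFReal_mul_pow {b β : ℝ} (hb : 0 < b) (hβ : 0 < β) (n : ℕ) (t : ℝ) :
    betaPDFReal b β t * t ^ n =
      ProbabilityTheory.beta (b + n) β / ProbabilityTheory.beta b β *
        betaPDFReal (b + n) β t := by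
  unfold betaPDFReal
  split_ifs with h
  · have h1 := (beta_pos hb hβ).ne'
    have h2 := (beta_pos (α := b + n) (by positivity) hβ).ne'
    have : t ^ (b + n - 1) = t ^ (b - 1) * t ^ n := by
      rw [add_sub_right_comm, Real.rpow_add h.1, Real.rpow_natCast]
    rw [this]
    field_simp
  · simp

lemma integral_pow_betaMeasure {b β : ℝ} (hb : 0 < b) (hβ : 0 < β) (n : ℕ) :
    ∫ t, t ^ n ∂betaMeasure b β =
      ProbabilityTheory.beta (b + n) β / ProbabilityTheory.beta b β := by
  rw [integral_betaMeasure hb hβ]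
  simp only [smul_eq_mul, betaPDFReal_mul_pow hb hβ]
  rw [integral_const_mul, integral_betaPDFReal (by positivity) hβ, mul_one]

lemma Gamma_add_natCast {b : ℝ} (hb : 0 < b) (n : ℕ) :
    Real.Gamma (b + n) = (ascPochhammer ℝ n).eval b * Real.Gamma b := by
  induction n with
  | zero => simp
  | succ n ih =>
    rw [Nat.cast_succ, ← add_assoc, Real.Gamma_add_one (by positivity), ih,
      ascPochhammer_succ_eval]
    ring

/-- With `c = b + β`, these are the factors `(b)ₙ / (c)ₙ` of the hypergeometric coefficients. -/
lemma integral_pow_betaMeasure_eq_pochhammer {b β : ℝ} (hb : 0 < b) (hβ : 0 < β) (n : ℕ) :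
    ∫ t, t ^ n ∂betaMeasure b β =
      (ascPochhammer ℝ n).eval b / (ascPochhammer ℝ n).eval (b + β) := by
  rw [integral_pow_betaMeasure hb hβ, ProbabilityTheory.beta, ProbabilityTheory.beta,
    add_right_comm, Gamma_add_natCast hb, Gamma_add_natCast (by positivity : 0 < b + β)]
  have h1 := (Real.Gamma_pos_of_pos hb).ne'
  have h2 := (Real.Gamma_pos_of_pos hβ).ne'
  have h3 := (Real.Gamma_pos_of_pos (by positivity : 0 < b + β)).ne'
  have h4 := (ascPochhammer_pos n (b + β) (by positivity)).ne'
  field_simp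

lemma integral_gammaMeasure {E : Type*} [NormedAddCommGroup E] [NormedSpace ℝ E]
    {a r : ℝ} (ha : 0 < a) (hr : 0 < r) (f : ℝ → E) :
    ∫ t, f t ∂gammaMeasure a r = ∫ t, gammaPDFReal a r t • f t := by
  rw [gammaMeasure, integral_withDensity_eq_integral_toReal_smul (measurable_gammaPDF a r)
    (ae_of_all _ fun _ => ENNReal.ofReal_lt_top)]
  simp only [gammaPDF, ENNReal.toReal_ofReal (gammaPDFReal_nonneg ha hr _)]

lemma integral_gammaPDFReal {a r : ℝ} (ha : 0 < a) (hr : 0 < r) :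
    ∫ t, gammaPDFReal a r t = 1 := by
  have := isProbabilityMeasure_gammaMeasure ha hr
  simpa using (integral_gammaMeasure ha hr (fun _ => (1 : ℝ))).symm

lemma integrable_gammaPDFReal {a r : ℝ} (ha : 0 < a) (hr : 0 < r) :
    Integrable (gammaPDFReal a r) :=
  -- The Bochner integral of a non-integrable function is `0`, so the value `1` forces
  -- integrability.
  .of_integral_ne_zero (by simp [integral_gammaPDFReal ha hr])

lemma gammaPDFReal_mul_pow {a r : ℝ} (ha : 0 < a) (hr : 0 < r) (n : ℕ) {t : ℝ} (ht : t ≠ 0) :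
    gammaPDFReal a r t * t ^ n =
      (ascPochhammer ℝ n).eval a / r ^ n * gammaPDFReal (a + n) r t := by
  unfold gammaPDFReal
  split_ifs with h
  · have h0 : 0 < t := lt_of_le_of_ne h ht.symm
    have h1 := (Real.Gamma_pos_of_pos ha).ne'
    have h2 := (ascPochhammer_pos n a ha).ne'
    have e : t ^ (a + n - 1) = t ^ (a - 1) * t ^ n := by
      rw [add_sub_right_comm, Real.rpow_add h0, Real.rpow_natCast]
    rw [e, Gamma_add_natCast ha, Real.rpow_add hr, Real.rpow_natCast]
    field_simp
  · simp

/-- `gammaPDFReal` uses its power formula at `0` as well, where exponents cannot be split by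
`Real.rpow_add`; that point is null. -/
lemma gammaPDFReal_mul_pow_ae {a r : ℝ} (ha : 0 < a) (hr : 0 < r) (n : ℕ) :
    (fun t => gammaPDFReal a r t * t ^ n) =ᵐ[volume]
      fun t => (ascPochhammer ℝ n).eval a / r ^ n * gammaPDFReal (a + n) r t := by
  filter_upwards [Measure.ae_ne volume 0] with t ht using gammaPDFReal_mul_pow ha hr n ht

lemma integral_pow_gammaMeasure {a r : ℝ} (ha : 0 < a) (hr : 0 < r) (n : ℕ) :
    ∫ t, t ^ n ∂gammaMeasure a r = (ascPochhammer ℝ n).eval a / r ^ n := by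
  rw [integral_gammaMeasure ha hr]
  simp only [smul_eq_mul]
  rw [integral_congr_ae (gammaPDFReal_mul_pow_ae ha hr n), integral_const_mul,
    integral_gammaPDFReal (by positivity) hr, mul_one]

lemma integrable_pow_gammaMeasure {a r : ℝ} (ha : 0 < a) (hr : 0 < r) (n : ℕ) :
    Integrable (fun t : ℝ => t ^ n) (gammaMeasure a r) := by
  rw [gammaMeasure, integrable_withDensity_iff_integrable_smul' (measurable_gammaPDF a r)
    (ae_of_all _ fun _ => ENNReal.ofReal_lt_top)]
  simp only [gammaPDF, ENNReal.toReal_ofReal (gammaPDFReal_nonneg ha hr _), smul_eq_mul]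
  exact ((integrable_gammaPDFReal (by positivity) hr).const_mul _).congr
    (gammaPDFReal_mul_pow_ae ha hr n).symm

lemma memLp_id_gammaMeasure {a r : ℝ} (ha : 0 < a) (hr : 0 < r) :
    MemLp (fun t : ℝ => t) 2 (gammaMeasure a r) :=
  (memLp_two_iff_integrable_sq (by fun_prop)).2 (integrable_pow_gammaMeasure ha hr 2)

lemma integral_id_gammaMeasure {a r : ℝ} (ha : 0 < a) (hr : 0 < r) :
    ∫ t, t ∂gammaMeasure a r = a / r := by
  simpa using integral_pow_gammaMeasure ha hr 1

lemma variance_id_gammaMeasure {a r : ℝ} (ha : 0 < a) (hr : 0 < r) :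
    variance (fun t : ℝ => t) (gammaMeasure a r) = a / r ^ 2 := by
  have := isProbabilityMeasure_gammaMeasure ha hr
  rw [variance_eq_sub (memLp_id_gammaMeasure ha hr), integral_id_gammaMeasure ha hr]
  have h := integral_pow_gammaMeasure ha hr 2
  simp only [Pi.pow_apply, h, ascPochhammer_succ_eval, ascPochhammer_zero]
  simp
  field_simp
  ring

lemma lintegral_gammaMeasure {a r : ℝ} {f : ℝ → ENNReal} (hf : Measurable f) :
    ∫⁻ u, f u ∂gammaMeasure a r =
      ∫⁻ u in Ioi 0, ENNReal.ofReal (gammaPDFReal a r u) * f u := by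
  rw [gammaMeasure, lintegral_withDensity_eq_lintegral_mul _ (measurable_gammaPDF a r) hf,
    restrict_Ioi_eq_restrict_Ici, ← lintegral_indicator measurableSet_Ici]
  refine lintegral_congr fun u => ?_
  by_cases hu : 0 ≤ u
  · simp [hu, gammaPDF]
  · simp [hu, gammaPDF, gammaPDFReal]

/-! ### The square of a standard normal variable -/

/-- The left factor `2 * x` is the Jacobian of squaring; the `2` on the right counts the roots `x`
and `-x`. -/
lemma two_mul_gammaPDFReal_sq {x : ℝ} (hx : 0 < x) :
    2 * x * gammaPDFReal (1 / 2) 2⁻¹ (x ^ 2) = 2 * gaussianPDFReal 0 1 x := by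
  rw [gammaPDFReal, if_pos (by positivity), gaussianPDFReal, Real.Gamma_one_half_eq]
  have e : (x ^ 2) ^ (1 / 2 - 1 : ℝ) = x⁻¹ := by
    rw [← Real.rpow_natCast, ← Real.rpow_mul hx.le]
    norm_num
    exact Real.rpow_neg_one x
  rw [e, ← Real.sqrt_eq_rpow, Real.sqrt_inv]
  have e2 : √(2 * Real.pi * (1 : NNReal)) = √2 * √Real.pi := by simp
  rw [e2]
  have e3 : -(2⁻¹ * x ^ 2) = -(x - 0) ^ 2 / (2 * (1 : NNReal)) := by
    push_cast; ring
  rw [e3]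
  have := Real.pi_pos
  field_simp

/-- The square of a standard normal variable has the Gamma law with shape `1 / 2` and
rate `1 / 2`. -/
lemma map_sq_gaussianReal :
    (gaussianReal 0 1).map (fun x => x ^ 2) = gammaMeasure (1 / 2) 2⁻¹ := by
  refine Measure.ext_of_lintegral _ fun f hf => ?_
  rw [lintegral_map hf (by fun_prop), lintegral_gammaMeasure hf,
    gaussianReal_of_var_ne_zero _ one_ne_zero,
    lintegral_withDensity_eq_lintegral_mul _ (by fun_prop) (by fun_prop)]
  have himg : (fun x : ℝ => x ^ 2) '' Ioi 0 = Ioi 0 := by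
    ext y
    constructor
    · rintro ⟨x, hx, rfl⟩
      exact pow_pos (mem_Ioi.1 hx) 2
    · intro hy
      exact ⟨√y, Real.sqrt_pos.2 hy, Real.sq_sqrt (le_of_lt hy)⟩
  have hinj : InjOn (fun x : ℝ => x ^ 2) (Ioi 0) := fun x hx y hy h =>
    (pow_left_inj₀ (le_of_lt hx) (le_of_lt hy) two_ne_zero).1 h
  have hcv := lintegral_image_eq_lintegral_abs_deriv_mul measurableSet_Ioi
    (fun x (_ : x ∈ Ioi (0 : ℝ)) => by simpa using (hasDerivAt_pow 2 x).hasDerivWithinAt) hinj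
    (fun u => ENNReal.ofReal (gammaPDFReal (1 / 2) 2⁻¹ u) * f u)
  rw [himg] at hcv
  rw [hcv]
  set g : ℝ → ENNReal := gaussianPDF 0 1 * fun x => f (x ^ 2) with hg
  -- By evenness the integral over the line is twice that over the positive half-line, where
  -- squaring is injective.
  have hsymm : ∀ x, g (-x) = g x := fun x => by
    simp [hg, gaussianPDF, gaussianPDFReal]
  have hneg : ∫⁻ x in Iio 0, g x = ∫⁻ x in Ioi 0, g x := by
    have := (Measure.measurePreserving_neg (volume : Measure ℝ)).setLIntegral_comp_preimage_emb
      (MeasurableEquiv.neg ℝ).measurableEmbedding g (Iio 0)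
    rw [← this]
    simp [hsymm]
  rw [← lintegral_add_compl g (measurableSet_Iio (a := (0 : ℝ))), compl_Iio,
    ← restrict_Ioi_eq_restrict_Ici, hneg, ← two_mul, ← lintegral_const_mul' _ _ (by simp)]
  refine setLIntegral_congr_fun measurableSet_Ioi fun x hx => ?_
  have hx : 0 < x := hx
  have h2 : ENNReal.ofReal |2 * x| * ENNReal.ofReal (gammaPDFReal (1 / 2) 2⁻¹ (x ^ 2)) =
      2 * gaussianPDF 0 1 x := by
    rw [← ENNReal.ofReal_mul (by positivity), abs_of_pos (by positivity),
      two_mul_gammaPDFReal_sq hx, ENNReal.ofReal_mul (by positivity)]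
    simp [gaussianPDF]
  simp only [hg, Pi.mul_apply]
  rw [← mul_assoc, ← mul_assoc, ← h2]

/-! ### Euler's integral and the analytic continuation -/

lemma isOpen_cutPlane : IsOpen cutPlane :=
  Complex.isOpen_slitPlane.preimage (continuous_const.sub continuous_id)

/-- `1 - z t` lies on the segment from `1` to `1 - z`, and the slit plane is star-shaped about `1`.
-/
lemma one_sub_mul_mem_slitPlane {z : ℂ} (hz : z ∈ cutPlane) {t : ℝ} (ht : t ∈ Icc (0 : ℝ) 1) :
    1 - z * t ∈ Complex.slitPlane := by
  have h := Complex.starConvex_one_slitPlane hz (sub_nonneg.2 ht.2) ht.1 (by ring)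
  have e : 1 - z * t = (1 - t) • (1 : ℂ) + t • (1 - z) := by
    simp only [Complex.real_smul]
    push_cast
    ring
  rwa [e]

/-- Euler's integral for the hypergeometric function, as a mean over the Beta distribution. -/
noncomputable def eulerIntegral (a : ℂ) (b β : ℝ) (z : ℂ) : ℂ :=
  ∫ t : ℝ, (1 - z * t) ^ (-a) ∂betaMeasure b β

lemma continuousOn_one_sub_mul_cpow (a : ℂ) :
    ContinuousOn (fun p : ℂ × ℝ => (1 - p.1 * p.2) ^ a) (cutPlane ×ˢ Icc (0 : ℝ) 1) := by
  refine ContinuousOn.cpow_const (by fun_prop) ?_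
  rintro ⟨z, t⟩ ⟨hz, ht⟩
  exact one_sub_mul_mem_slitPlane hz ht

lemma measurable_one_sub_mul_cpow (a z : ℂ) :
    Measurable fun t : ℝ => (1 - z * t) ^ a := by
  fun_prop

lemma differentiableOn_eulerIntegral (a : ℂ) {b β : ℝ} (hb : 0 < b) (hβ : 0 < β) :
    DifferentiableOn ℂ (eulerIntegral a b β) cutPlane := by
  have := isProbabilityMeasureBeta hb hβ
  intro z₀ hz₀
  obtain ⟨r, hr, hball⟩ := Metric.nhds_basis_closedBall.mem_iff.1 (isOpen_cutPlane.mem_nhds hz₀)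
  -- On this compact set continuity bounds the integrand (by `D`) and the power in its
  -- `z`-derivative (by `C`), which permits differentiation under the integral.
  have hK : IsCompact (Metric.closedBall z₀ r ×ˢ Icc (0 : ℝ) 1) :=
    (isCompact_closedBall z₀ r).prod isCompact_Icc
  have hsub := prod_mono hball (Subset.refl (Icc (0 : ℝ) 1))
  obtain ⟨C, hC⟩ := hK.exists_bound_of_continuousOn
    ((continuousOn_one_sub_mul_cpow (-a - 1)).mono hsub)
  obtain ⟨D, hD⟩ := hK.exists_bound_of_continuousOn
    ((continuousOn_one_sub_mul_cpow (-a)).mono hsub)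
  have hmem : ∀ᵐ t ∂betaMeasure b β, t ∈ Icc (0 : ℝ) 1 :=
    (ae_betaMeasure_mem_Ioo b β).mono fun t ht => Ioo_subset_Icc_self ht
  refine (hasDerivAt_integral_of_dominated_loc_of_deriv_le (𝕜 := ℂ)
    (F := fun z (t : ℝ) => (1 - z * t) ^ (-a))
    (F' := fun z (t : ℝ) => -a * (1 - z * t) ^ (-a - 1) * (-t)) (bound := fun _ => ‖a‖ * C)
    (Metric.closedBall_mem_nhds z₀ hr)
    (.of_forall fun z => (measurable_one_sub_mul_cpow _ z).aestronglyMeasurable) ?_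
    (Measurable.aestronglyMeasurable (by fun_prop)) ?_ (integrable_const _)
    ?_).2.differentiableAt.differentiableWithinAt
  · refine Integrable.of_bound (measurable_one_sub_mul_cpow _ z₀).aestronglyMeasurable D
      (hmem.mono fun t ht => ?_)
    exact hD (z₀, t) ⟨Metric.mem_closedBall_self hr.le, ht⟩
  · refine hmem.mono fun t ht z hz => ?_
    have h1 := hC (z, t) ⟨hz, ht⟩
    have h2 : ‖(-t : ℂ)‖ ≤ 1 := by
      rw [norm_neg, Complex.norm_real, Real.norm_of_nonneg ht.1]
      exact ht.2
    rw [norm_mul, norm_mul, norm_neg]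
    calc _ ≤ ‖a‖ * C * 1 := by
          have hC0 := (norm_nonneg _).trans h1
          gcongr
      _ = _ := mul_one _
  · refine hmem.mono fun t ht z hz => ?_
    have h : HasDerivAt (fun z : ℂ => 1 - z * t) (-t) z := by
      simpa using ((hasDerivAt_id z).mul_const (t : ℂ)).const_sub 1
    exact h.cpow_const (one_sub_mul_mem_slitPlane (hball hz) ht)

lemma hasSum_one_sub_cpow (a : ℂ) {z : ℂ} (hz : ‖z‖ < 1) :
    HasSum (fun n : ℕ => ((n.factorial : ℂ)⁻¹ * (ascPochhammer ℂ n).eval a) * z ^ n)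
      ((1 - z) ^ (-a)) := by
  have h := (Complex.one_div_one_sub_cpow_hasFPowerSeriesOnBall_zero a).hasSum
    (y := z) (by simpa [Metric.mem_eball, edist_zero_right, ← ofReal_norm] using hz)
  simp only [zero_add, FormalMultilinearSeries.ofScalars_apply_eq, smul_eq_mul] at h
  rw [Complex.cpow_neg, ← one_div]
  refine h.congr_fun fun n => ?_
  congr 1
  rw [← Ring.multichoose_eq, inv_mul_eq_iff_eq_mul₀ (by exact_mod_cast n.factorial_ne_zero),
    ← nsmul_eq_mul, Ring.factorial_nsmul_multichoose_eq_ascPochhammer,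
    Polynomial.ascPochhammer_smeval_eq_eval]

/-- The binomial series of the kernel is integrated term by term; since `0 ≤ t ≤ 1`, its terms are
dominated by those of the absolutely convergent series at `z`. -/
lemma eulerIntegral_eq_series (a : ℂ) {b β : ℝ} (hb : 0 < b) (hβ : 0 < β) {z : ℂ}
    (hz : ‖z‖ < 1) : eulerIntegral a b β z = ₂F₁ a (b : ℂ) ((b + β : ℝ) : ℂ) z := by
  have := isProbabilityMeasureBeta hb hβ
  have hmem : ∀ᵐ t ∂betaMeasure b β, t ∈ Icc (0 : ℝ) 1 :=
    (ae_betaMeasure_mem_Ioo b β).mono fun t ht => Ioo_subset_Icc_self ht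
  set c : ℕ → ℂ := fun n => (n.factorial : ℂ)⁻¹ * (ascPochhammer ℂ n).eval a
  have hterm : ∀ (n : ℕ) (t : ℝ), t ∈ Icc (0 : ℝ) 1 → ‖c n * (z * t) ^ n‖ ≤ ‖c n * z ^ n‖ := by
    intro n t ht
    rw [mul_pow, ← mul_assoc, norm_mul, norm_pow, Complex.norm_real, Real.norm_of_nonneg ht.1]
    exact mul_le_of_le_one_right (norm_nonneg _) (pow_le_one₀ ht.1 ht.2)
  have hint : ∀ n, Integrable (fun t : ℝ => c n * (z * t) ^ n) (betaMeasure b β) := fun n =>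
    Integrable.of_bound (by fun_prop) _ (hmem.mono (hterm n))
  have hsum : Summable fun n => ∫ t : ℝ, ‖c n * (z * t) ^ n‖ ∂betaMeasure b β := by
    refine Summable.of_nonneg_of_le (fun n => integral_nonneg fun _ => norm_nonneg _)
      (fun n => ?_) (hasSum_one_sub_cpow a hz).summable.norm
    calc _ ≤ ∫ _, ‖c n * z ^ n‖ ∂betaMeasure b β :=
          integral_mono_ae (hint n).norm (integrable_const _) (hmem.mono (hterm n))
      _ = _ := by simp [c]
  have h := hasSum_integral_of_summable_integral_norm hint hsum
  rw [ordinaryHypergeometric_eq_tsum, eulerIntegral]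
  refine Eq.trans ?_ (h.tsum_eq.symm.trans (tsum_congr fun n => ?_))
  · refine integral_congr_ae (hmem.mono fun t ht => ?_)
    have hzt : ‖z * t‖ < 1 := by
      rw [norm_mul, Complex.norm_real, Real.norm_of_nonneg ht.1]
      exact (mul_le_of_le_one_right (norm_nonneg _) ht.2).trans_lt hz
    exact (hasSum_one_sub_cpow a hzt).tsum_eq.symm
  · have e : ∀ t : ℝ, c n * (z * t) ^ n = c n * z ^ n * ((t ^ n : ℝ) : ℂ) := fun t => by
      push_cast; ring
    have hp : ∀ x : ℝ, (((ascPochhammer ℝ n).eval x : ℝ) : ℂ) = (ascPochhammer ℂ n).eval (x : ℂ) :=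
      fun x => by
        rw [← Complex.ofRealHom_eq_coe, ← Polynomial.eval₂_at_apply,
          ← ascPochhammer_eval₂ Complex.ofRealHom n, Complex.ofRealHom_eq_coe]
    simp only [e]
    rw [integral_const_mul, integral_complex_ofReal, integral_pow_betaMeasure_eq_pochhammer hb hβ,
      Complex.ofReal_div, hp, hp]
    simp only [c, smul_eq_mul]
    ring

lemma isGaussHypergeometric_eulerIntegral (a : ℂ) {b β : ℝ} (hb : 0 < b) (hβ : 0 < β) :
    IsGaussHypergeometric a b ((b + β : ℝ) : ℂ) (eulerIntegral a b β) :=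
  ⟨differentiableOn_eulerIntegral a hb hβ, fun _ => eulerIntegral_eq_series a hb hβ⟩

/-- Euler's integral singles out the Beta parameter `3/2` as second argument, while the closed form
lists it first. -/
lemma IsGaussHypergeometric.symm {a b c : ℂ} {F : ℂ → ℂ} (h : IsGaussHypergeometric a b c F) :
    IsGaussHypergeometric b a c F :=
  ⟨h.differentiableOn, fun z hz => by
    rw [h.eq_series z hz, ordinaryHypergeometric, ordinaryHypergeometricSeries_symm,
      ordinaryHypergeometric]⟩

/-! ### The density `x•` -/

lemma measurable_xPDF (α γ : ℝ) : Measurable (xPDF α γ) := by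
  unfold xPDF
  exact Measurable.mul (by fun_prop) ((measurable_betaPDFReal _ _).comp (by fun_prop))

/-- The denominator is the convex combination `(1 - z) + γ z` of `1` and `γ`. -/
lemma one_sub_mul_pos {γ z : ℝ} (hγ : 0 < γ) (hz : z ∈ Ioo (0 : ℝ) 1) :
    0 < 1 - (1 - γ) * z := by
  nlinarith [mul_pos hγ hz.1, hz.2]

lemma xPDF_eq_zero {α γ z : ℝ} (hγ : 0 < γ) (hz : z ∉ Ioo (0 : ℝ) 1) : xPDF α γ z = 0 := by
  rw [xPDF, betaPDFReal, if_neg, mul_zero]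
  rintro ⟨h1, h2⟩
  refine hz ?_
  rcases lt_trichotomy (1 - (1 - γ) * z) 0 with h | h | h
  -- With a negative denominator, a positive quotient forces `z < 0` while a quotient below `1`
  -- forces `z > 1`.
  · rw [div_lt_one_of_neg h] at h2
    have h3 : γ * z < 0 := by
      rcases div_pos_iff.1 h1 with h' | h'
      · exact absurd h (not_lt.2 h'.2.le)
      · exact h'.1
    have h4 : z < 0 := by
      by_contra h5
      exact absurd h3 (not_lt.2 (mul_nonneg hγ.le (not_lt.1 h5)))
    linarith
  -- Division by zero returns `0`, which is not in the open interval.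
  · simp [h] at h1
  · rw [div_lt_one h] at h2
    have h3 : 0 < γ * z := by
      rcases div_pos_iff.1 h1 with h' | h'
      · exact h'.1
      · exact absurd h (not_lt.2 h'.2.le)
    exact ⟨pos_of_mul_pos_right h3 hγ.le, by linarith⟩

lemma xPDF_of_mem_Ioo {α γ z : ℝ} (hγ : 0 < γ) (hz : z ∈ Ioo (0 : ℝ) 1) :
    xPDF α γ z = γ ^ (1 / 2 : ℝ) / ProbabilityTheory.beta (1 / 2) α * z ^ (1 / 2 - 1 : ℝ) *
      (1 - z) ^ (α - 1) * (1 - (1 - γ) * z) ^ (-(1 / 2 + α)) := by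
  have hD := one_sub_mul_pos hγ hz
  have hz1 : 0 < 1 - z := sub_pos.2 hz.2
  have e : 1 - γ * z / (1 - (1 - γ) * z) = (1 - z) / (1 - (1 - γ) * z) := by
    rw [eq_div_iff hD.ne', sub_mul, div_mul_cancel₀ _ hD.ne']
    ring
  rw [xPDF, betaPDFReal, if_pos, e, Real.div_rpow (mul_pos hγ hz.1).le hD.le,
    Real.mul_rpow hγ.le hz.1.le, Real.div_rpow hz1.le hD.le]
  swap
  · refine ⟨div_pos (mul_pos hγ hz.1) hD, ?_⟩
    rw [div_lt_one hD]
    linarith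
  set D := 1 - (1 - γ) * z
  -- The powers of `D` come from the prefactor, from the Beta argument `γ z / D`, and from its
  -- complement `(1 - z) / D`.
  have e1 : D ^ (-(1 / 2 + α)) = ((D ^ 2) * D ^ (1 / 2 - 1 : ℝ) * D ^ (α - 1))⁻¹ := by
    rw [← Real.rpow_natCast, ← Real.rpow_add hD, ← Real.rpow_add hD, ← Real.rpow_neg hD.le]
    congr 1
    push_cast
    ring
  have e2 : γ ^ (1 / 2 : ℝ) = γ * γ ^ (1 / 2 - 1 : ℝ) := by
    conv_rhs => rw [← Real.rpow_one_add' hγ.le (by norm_num)]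
    norm_num
  rw [e1, e2]
  field_simp

lemma xPDF_pos {α γ z : ℝ} (hα : 0 < α) (hγ : 0 < γ) (hz : z ∈ Ioo (0 : ℝ) 1) :
    0 < xPDF α γ z := by
  rw [xPDF_of_mem_Ioo hγ hz]
  have h1 := beta_pos (α := 1 / 2) (by norm_num) hα
  have h2 := hz.1
  have h3 := sub_pos.2 hz.2
  have h4 := one_sub_mul_pos hγ hz
  positivity

lemma xPDF_nonneg {α γ : ℝ} (hα : 0 < α) (hγ : 0 < γ) (z : ℝ) : 0 ≤ xPDF α γ z := by
  by_cases hz : z ∈ Ioo (0 : ℝ) 1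
  · exact (xPDF_pos hα hγ hz).le
  · exact (xPDF_eq_zero hγ hz).ge

lemma tsupport_xPDF {α γ : ℝ} (hα : 0 < α) (hγ : 0 < γ) : tsupport (xPDF α γ) = Icc 0 1 := by
  have : Function.support (xPDF α γ) = Ioo 0 1 := by
    ext z
    refine ⟨fun h => ?_, fun hz => (xPDF_pos hα hγ hz).ne'⟩
    by_contra hz
    exact h (xPDF_eq_zero hγ hz)
  rw [tsupport, this, closure_Ioo zero_ne_one]

/-! ### The law of `U / (U + V)` -/

/-- The integral over the size `u` in the density of `U / (U + V)` at `z`. -/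
lemma lintegral_gammaPDFReal_mul_gammaPDFReal {α γ z : ℝ} (hα : 0 < α) (hγ : 0 < γ)
    (hz : z ∈ Ioo (0 : ℝ) 1) :
    ∫⁻ u in Ioi 0, ENNReal.ofReal (gammaPDFReal (1 / 2) 2⁻¹ u *
      (u / z ^ 2 * gammaPDFReal α (2 * γ)⁻¹ (u * ((1 - z) / z)))) =
      ENNReal.ofReal (xPDF α γ z) := by
  have hz0 := hz.1
  have hz1 : 0 < 1 - z := sub_pos.2 hz.2
  have hD := one_sub_mul_pos hγ hz
  set D := 1 - (1 - γ) * z with hDdef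
  -- The two exponentials combine to the rate `1/2 + (1 - z)/(2γz) = D/(2γz)`; the powers of `u`
  -- combine to shape `1/2 + α`.
  set r := D / (2 * γ * z) with hr
  have hrpos : 0 < r := by positivity
  have hΓ1 := Real.Gamma_pos_of_pos (show (0 : ℝ) < 1 / 2 by norm_num)
  have hΓ2 := Real.Gamma_pos_of_pos hα
  have hΓ3 := Real.Gamma_pos_of_pos (show (0 : ℝ) < 1 / 2 + α by positivity)
  have key : ∀ u ∈ Ioi (0 : ℝ), ENNReal.ofReal (gammaPDFReal (1 / 2) 2⁻¹ u *
      (u / z ^ 2 * gammaPDFReal α (2 * γ)⁻¹ (u * ((1 - z) / z)))) =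
      ENNReal.ofReal (xPDF α γ z) * gammaPDF (1 / 2 + α) r u := by
    intro u hu
    have hu : 0 < u := hu
    rw [gammaPDF, ← ENNReal.ofReal_mul (xPDF_nonneg hα hγ z), xPDF_of_mem_Ioo hγ hz,
      gammaPDFReal, gammaPDFReal, gammaPDFReal, if_pos hu.le, if_pos hu.le,
      if_pos (by positivity), ProbabilityTheory.beta, ← hDdef]
    congr 1
    have e1 : Real.exp (-(r * u)) =
        Real.exp (-(2⁻¹ * u)) * Real.exp (-((2 * γ)⁻¹ * (u * ((1 - z) / z)))) := by
      rw [← Real.exp_add]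
      congr 1
      rw [hr, hDdef]
      field_simp
      ring
    have e2 : r ^ (1 / 2 + α) = D ^ (1 / 2 + α) *
        ((2⁻¹ : ℝ) ^ (1 / 2 : ℝ) * ((2 * γ)⁻¹) ^ α * (γ ^ (1 / 2 : ℝ))⁻¹ *
          (z ^ (1 / 2 : ℝ) * z ^ α)⁻¹) := by
      rw [← Real.rpow_add hz0, hr, Real.div_rpow hD.le (by positivity),
        Real.mul_rpow (by positivity) hz0.le, Real.rpow_add hD,
        Real.rpow_add (by positivity : 0 < 2 * γ),
        Real.mul_rpow (by positivity : (0 : ℝ) ≤ 2) hγ.le (z := 1 / 2),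
        Real.inv_rpow (by positivity), Real.inv_rpow (by positivity)]
      field_simp
    have e3 : u ^ (1 / 2 + α - 1) = u ^ (1 / 2 - 1 : ℝ) * u * u ^ (α - 1) := by
      nth_rw 3 [← Real.rpow_one u]
      rw [← Real.rpow_add hu, ← Real.rpow_add hu]
      congr 1
      ring
    have e4 : z ^ (1 / 2 - 1 : ℝ) = z ^ (1 / 2 : ℝ) * z⁻¹ := by
      rw [Real.rpow_sub_one hz0.ne', div_eq_mul_inv]
    have e5 : z ^ (α - 1) = z ^ α * z⁻¹ := by
      rw [Real.rpow_sub_one hz0.ne', div_eq_mul_inv]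
    rw [Real.mul_rpow hu.le (by positivity), Real.div_rpow hz1.le hz0.le, e1, e2, e3, e4, e5,
      Real.rpow_neg hD.le]
    field_simp
  rw [setLIntegral_congr_fun measurableSet_Ioi key, lintegral_const_mul _ (measurable_gammaPDF _ _)]
  have hone : ∫⁻ u in Ioi 0, gammaPDF (1 / 2 + α) r u = 1 := by
    rw [← lintegral_gammaPDF_eq_one (show 0 < 1 / 2 + α by positivity) hrpos,
      ← lintegral_add_compl (μ := volume) (gammaPDF (1 / 2 + α) r)
        (measurableSet_Iio (a := (0 : ℝ))),
      lintegral_gammaPDF_of_nonpos le_rfl, zero_add, compl_Iio, restrict_Ioi_eq_restrict_Ici]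
  rw [hone, mul_one]

/-- At fixed `u`, the substitution `v = u (1 - z) / z` inverts `z = u / (u + v)` and has Jacobian `u
/ z ^ 2`. -/
lemma lintegral_div_add_gammaMeasure {a r u : ℝ} (hu : 0 < u) {f : ℝ → ENNReal}
    (hf : Measurable f) :
    ∫⁻ v, f (u / (u + v)) ∂gammaMeasure a r =
      ∫⁻ z in Ioo 0 1, ENNReal.ofReal (u / z ^ 2) *
        (ENNReal.ofReal (gammaPDFReal a r (u * ((1 - z) / z))) * f z) := by
  have himg : (fun z : ℝ => u * ((1 - z) / z)) '' Ioo 0 1 = Ioi 0 := by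
    ext v
    constructor
    · rintro ⟨z, hz, rfl⟩
      have := sub_pos.2 hz.2
      have := hz.1
      simp only [mem_Ioi]
      positivity
    · intro hv
      have hv : 0 < v := hv
      refine ⟨u / (u + v), ⟨by positivity, ?_⟩, ?_⟩
      · rw [div_lt_one (by positivity)]
        linarith
      · field_simp
        ring
  have hinv : ∀ z ∈ Ioo (0 : ℝ) 1, u / (u + u * ((1 - z) / z)) = z := by
    intro z hz
    have := hz.1
    field_simp
    ring
  have hinj : InjOn (fun z : ℝ => u * ((1 - z) / z)) (Ioo 0 1) := fun x hx y hy h => by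
    rw [← hinv x hx, ← hinv y hy]
    simp only at h
    rw [h]
  have hder : ∀ z ∈ Ioo (0 : ℝ) 1,
      HasDerivWithinAt (fun z : ℝ => u * ((1 - z) / z)) (-(u / z ^ 2)) (Ioo 0 1) z := by
    intro z hz
    have h := ((((hasDerivAt_id z).const_sub 1).div (hasDerivAt_id z) hz.1.ne').const_mul u)
    refine (h.congr_deriv ?_).hasDerivWithinAt
    simp only [id]
    ring
  rw [lintegral_gammaMeasure (by fun_prop), ← himg,
    lintegral_image_eq_lintegral_abs_deriv_mul measurableSet_Ioo hder hinj]
  refine setLIntegral_congr_fun measurableSet_Ioo fun z hz => ?_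
  have := hz.1
  rw [hinv z hz, abs_neg, abs_of_pos (by positivity)]

/-- The density of `U / (U + V)` for independent Gamma variables `U` and `V`. -/
lemma map_div_add_gammaMeasure {α γ : ℝ} (hα : 0 < α) (hγ : 0 < γ) :
    ((gammaMeasure (1 / 2) 2⁻¹).prod (gammaMeasure α (2 * γ)⁻¹)).map
        (fun p => p.1 / (p.1 + p.2)) =
      volume.withDensity fun z => ENNReal.ofReal (xPDF α γ z) := by
  have := isProbabilityMeasure_gammaMeasure hα (show 0 < (2 * γ)⁻¹ by positivity)
  refine Measure.ext_of_lintegral _ fun f hf => ?_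
  have hm : Measurable fun p : ℝ × ℝ => p.1 / (p.1 + p.2) := by fun_prop
  have hfm : Measurable fun p : ℝ × ℝ => f (p.1 / (p.1 + p.2)) := hf.comp hm
  rw [lintegral_map hf hm, lintegral_prod _ hfm.aemeasurable,
    lintegral_gammaMeasure hfm.lintegral_prod_right',
    lintegral_withDensity_eq_lintegral_mul _ (measurable_xPDF α γ).ennreal_ofReal hf]
  have h1 : ∀ u ∈ Ioi (0 : ℝ), ENNReal.ofReal (gammaPDFReal (1 / 2) 2⁻¹ u) *
      ∫⁻ v, f (u / (u + v)) ∂gammaMeasure α (2 * γ)⁻¹ =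
      ∫⁻ z in Ioo 0 1, ENNReal.ofReal (gammaPDFReal (1 / 2) 2⁻¹ u *
        (u / z ^ 2 * gammaPDFReal α (2 * γ)⁻¹ (u * ((1 - z) / z)))) * f z := by
    intro u hu
    have hu : 0 < u := hu
    rw [lintegral_div_add_gammaMeasure hu hf, ← lintegral_const_mul' _ _ ENNReal.ofReal_ne_top]
    refine lintegral_congr fun z => ?_
    rw [ENNReal.ofReal_mul (gammaPDFReal_nonneg (by norm_num) (by norm_num) u),
      ENNReal.ofReal_mul (by positivity)]
    ring
  -- After the exchange `f z` leaves the inner integral, and what remains is the density at `z`.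
  rw [setLIntegral_congr_fun measurableSet_Ioi h1, lintegral_lintegral_swap]
  · have h2 : ∀ z ∉ Ioo (0 : ℝ) 1, ENNReal.ofReal (xPDF α γ z) * f z = 0 := fun z hz => by
      simp [xPDF_eq_zero hγ hz]
    rw [← lintegral_indicator measurableSet_Ioo]
    refine lintegral_congr fun z => ?_
    simp only [Pi.mul_apply]
    by_cases hz : z ∈ Ioo (0 : ℝ) 1
    · rw [indicator_of_mem hz, lintegral_mul_const,
        lintegral_gammaPDFReal_mul_gammaPDFReal hα hγ hz]
      fun_prop
    · rw [indicator_of_notMem hz, h2 z hz]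
  · apply Measurable.aemeasurable
    fun_prop

lemma hasLaw_div_add {α γ : ℝ} (hα : 0 < α) (hγ : 0 < γ) {Ω : Type*} [MeasurableSpace Ω]
    {P : Measure Ω} [IsProbabilityMeasure P] {U V : Ω → ℝ}
    (hU : HasLaw U (gammaScale (1 / 2) 2) P) (hV : HasLaw V (gammaScale α (2 * γ)) P)
    (hUV : IndepFun U V P) :
    HasLaw (fun ω => U ω / (U ω + V ω))
      (volume.withDensity fun z => ENNReal.ofReal (xPDF α γ z)) P where
  aemeasurable := hU.aemeasurable.div (hU.aemeasurable.add hV.aemeasurable)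
  map_eq := by
    rw [← map_div_add_gammaMeasure hα hγ]
    have h := (indepFun_iff_map_prod_eq_prod_map_map hU.aemeasurable hV.aemeasurable).1 hUV
    rw [hU.map_eq, hV.map_eq, gammaScale, gammaScale] at h
    rw [← h, AEMeasurable.map_map_of_aemeasurable
      (Measurable.aemeasurable (by fun_prop)) (hU.aemeasurable.prodMk hV.aemeasurable)]
    rfl

lemma integral_withDensity_xPDF {α γ : ℝ} (hα : 0 < α) (hγ : 0 < γ) :
    ∫ z, z ∂(volume.withDensity fun z => ENNReal.ofReal (xPDF α γ z)) =
      ∫ z in (0 : ℝ)..1, z * xPDF α γ z := by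
  rw [integral_withDensity_eq_integral_toReal_smul (measurable_xPDF α γ).ennreal_ofReal
    (ae_of_all _ fun _ => ENNReal.ofReal_lt_top), intervalIntegral.integral_of_le zero_le_one,
    integral_Ioc_eq_integral_Ioo, ← integral_indicator measurableSet_Ioo]
  refine integral_congr_ae (ae_of_all _ fun z => ?_)
  simp only [ENNReal.toReal_ofReal (xPDF_nonneg hα hγ z), smul_eq_mul]
  by_cases hz : z ∈ Ioo (0 : ℝ) 1
  · rw [indicator_of_mem hz, mul_comm]
  · rw [indicator_of_notMem hz, xPDF_eq_zero hγ hz, zero_mul]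

lemma integrable_div_add {Ω : Type*} [MeasurableSpace Ω] {P : Measure Ω} [IsFiniteMeasure P]
    {U V : Ω → ℝ} (hU : AEMeasurable U P) (hV : AEMeasurable V P)
    (hU0 : ∀ᵐ ω ∂P, 0 ≤ U ω) (hV0 : ∀ᵐ ω ∂P, 0 ≤ V ω) :
    Integrable (fun ω => U ω / (U ω + V ω)) P := by
  refine Integrable.of_bound (hU.div (hU.add hV)).aestronglyMeasurable 1 ?_
  filter_upwards [hU0, hV0] with ω h1 h2
  rw [Real.norm_of_nonneg (by positivity)]
  -- This bound includes `U ω = V ω = 0`, where the quotient is `0` by convention.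
  exact div_le_one_of_le₀ (by linarith) (by positivity)

lemma ae_gammaMeasure_nonneg (a r : ℝ) : ∀ᵐ t ∂gammaMeasure a r, 0 ≤ t := by
  rw [gammaMeasure, ae_withDensity_iff (measurable_gammaPDF a r)]
  refine ae_of_all _ fun t ht => ?_
  by_contra h
  exact ht (gammaPDF_of_neg (not_le.1 h))

lemma HasLaw.ae_nonneg_of_gammaScale {Ω : Type*} [MeasurableSpace Ω] {P : Measure Ω} {U : Ω → ℝ}
    {a θ : ℝ} (hU : HasLaw U (gammaScale a θ) P) : ∀ᵐ ω ∂P, 0 ≤ U ω :=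
  (hU.ae_iff (p := fun t => 0 ≤ t) (measurableSet_setOfPred.1 measurableSet_Ici)).2
    (ae_gammaMeasure_nonneg a θ⁻¹)

/-! ### The mean in closed form -/

/-- The extra factor `z` raises the Beta parameter from `1/2` to `3/2`, exposing the integrand of
Euler's integral. -/
lemma mul_xPDF {α γ z : ℝ} (hα : 0 < α) (hγ : 0 < γ) :
    z * xPDF α γ z = γ ^ (1 / 2 : ℝ) *
      (ProbabilityTheory.beta (3 / 2) α / ProbabilityTheory.beta (1 / 2) α) *
        (betaPDFReal (3 / 2) α z * (1 - (1 - γ) * z) ^ (-(1 / 2 + α))) := by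
  by_cases hz : z ∈ Ioo (0 : ℝ) 1
  · rw [xPDF_of_mem_Ioo hγ hz, betaPDFReal, if_pos (mem_Ioo.1 hz)]
    have h1 := beta_pos (α := 3 / 2) (by norm_num) hα
    have e : z ^ (3 / 2 - 1 : ℝ) = z * z ^ (1 / 2 - 1 : ℝ) := by
      rw [← Real.rpow_one_add' hz.1.le (by norm_num)]
      norm_num
    rw [e]
    field_simp
  · rw [xPDF_eq_zero hγ hz, betaPDFReal, if_neg (by simpa using hz)]
    simp

lemma integrable_mul_xPDF {α γ : ℝ} (hα : 0 < α) (hγ : 0 < γ) :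
    IntervalIntegrable (fun z => z * xPDF α γ z) volume 0 1 := by
  have h1 : Integrable (xPDF α γ) := by
    rw [← lintegral_ofReal_ne_top_iff_integrable (measurable_xPDF α γ).aestronglyMeasurable
      (ae_of_all _ (xPDF_nonneg hα hγ))]
    -- The total mass of `xPDF` is that of the image of a probability measure, hence finite.
    have h := congrArg (fun μ => μ univ) (map_div_add_gammaMeasure hα hγ)
    have := isProbabilityMeasure_gammaMeasure (a := 1 / 2) (r := 2⁻¹) (by norm_num) (by norm_num)
    have := isProbabilityMeasure_gammaMeasure hα (show 0 < (2 * γ)⁻¹ by positivity)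
    simp only [withDensity_apply _ MeasurableSet.univ, Measure.restrict_univ] at h
    rw [← h]
    exact measure_ne_top _ _
  exact h1.intervalIntegrable.continuousOn_mul continuousOn_id

lemma integral_mul_xPDF {α γ : ℝ} (hα : 0 < α) (hγ : 0 < γ) :
    ((∫ z in (0 : ℝ)..1, z * xPDF α γ z : ℝ) : ℂ) =
      ((γ ^ (1 / 2 : ℝ) * (Real.Gamma (3 / 2) * Real.Gamma (1 / 2 + α) /
          (Real.Gamma (1 / 2) * Real.Gamma (3 / 2 + α))) : ℝ) : ℂ) *
        hyp2F1 (3 / 2) (1 / 2 + α) (3 / 2 + α) (1 - γ) := by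
  have hmem : (1 - γ : ℂ) ∈ cutPlane := by simp [cutPlane, hγ]
  have hF := (isGaussHypergeometric_eulerIntegral (1 / 2 + α) (b := 3 / 2) (by norm_num) hα).symm
  have hF' := hF.eqOn hmem
  push_cast at hF'
  rw [hF', eulerIntegral, integral_betaMeasure (by norm_num) hα]
  have e : ∀ t : ℝ, betaPDFReal (3 / 2) α t • ((1 - (1 - γ) * t) ^ (-(1 / 2 + α) : ℂ) : ℂ) =
      ((betaPDFReal (3 / 2) α t * (1 - (1 - γ) * t) ^ (-(1 / 2 + α)) : ℝ) : ℂ) := by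
    intro t
    by_cases ht : t ∈ Ioo (0 : ℝ) 1
    · rw [Complex.real_smul, Complex.ofReal_mul, Complex.ofReal_cpow (one_sub_mul_pos hγ ht).le]
      push_cast
      rfl
    · rw [betaPDFReal, if_neg (by simpa using ht)]
      simp
  simp only [e]
  rw [integral_complex_ofReal, ← Complex.ofReal_mul, ← integral_const_mul]
  congr 1
  -- `Γ(α)` cancels in the quotient of the Beta constants.
  have hc : Real.Gamma (3 / 2) * Real.Gamma (1 / 2 + α) /
      (Real.Gamma (1 / 2) * Real.Gamma (3 / 2 + α)) =
      ProbabilityTheory.beta (3 / 2) α / ProbabilityTheory.beta (1 / 2) α := by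
    have h1 := Real.Gamma_pos_of_pos (show (0 : ℝ) < 1 / 2 by norm_num)
    have h2 := Real.Gamma_pos_of_pos hα
    have h3 := Real.Gamma_pos_of_pos (show (0 : ℝ) < 1 / 2 + α by positivity)
    have h4 := Real.Gamma_pos_of_pos (show (0 : ℝ) < 3 / 2 + α by positivity)
    unfold ProbabilityTheory.beta
    field_simp
  rw [hc, intervalIntegral.integral_of_le zero_le_one,
    integral_Ioc_eq_integral_Ioo, ← integral_indicator measurableSet_Ioo]
  refine integral_congr_ae (ae_of_all _ fun z => ?_)
  simp only [← mul_xPDF hα hγ]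
  by_cases hz : z ∈ Ioo (0 : ℝ) 1
  · rw [indicator_of_mem hz]
  · rw [indicator_of_notMem hz, xPDF_eq_zero hγ hz, mul_zero]

lemma integral_div_add {α γ : ℝ} (hα : 0 < α) (hγ : 0 < γ) {Ω : Type*} [MeasurableSpace Ω]
    {P : Measure Ω} [IsProbabilityMeasure P] {U V : Ω → ℝ}
    (hU : HasLaw U (gammaScale (1 / 2) 2) P) (hV : HasLaw V (gammaScale α (2 * γ)) P)
    (hUV : IndepFun U V P) :
    ∫ ω, U ω / (U ω + V ω) ∂P = ∫ z in (0 : ℝ)..1, z * xPDF α γ z := by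
  rw [(hasLaw_div_add hα hγ hU hV hUV).integral_eq, integral_withDensity_xPDF hα hγ]

/-! ### Moments and independence of `u` and `vᵢ` -/

variable {d : ℕ} {σ : Fin d → ℝ} {k : ℕ} {i : Fin d}

instance : IsProbabilityMeasure (stdNormal d) := by
  unfold stdNormal
  infer_instance

lemma beta_nonneg (σ : Fin d → ℝ) (k : ℕ) (l : Fin d) : 0 ≤ beta σ k l := sq_nonneg _

lemma sum_beta_sq_pos (hβ : 0 < ∑ l ∈ Finset.univ.erase i, beta σ k l) :
    0 < ∑ l ∈ Finset.univ.erase i, beta σ k l ^ 2 := by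
  obtain ⟨l, hl, h⟩ := Finset.exists_ne_zero_of_sum_ne_zero hβ.ne'
  exact Finset.sum_pos' (fun l _ => sq_nonneg _)
    ⟨l, hl, pow_pos ((beta_nonneg σ k l).lt_of_ne' h) 2⟩

lemma alpha_pos (hβ : 0 < ∑ l ∈ Finset.univ.erase i, beta σ k l) : 0 < alpha σ k i := by
  have := sum_beta_sq_pos hβ
  unfold alpha
  positivity

lemma gam_pos (hβi : 0 < beta σ k i) (hβ : 0 < ∑ l ∈ Finset.univ.erase i, beta σ k l) :
    0 < gam σ k i := by
  have := sum_beta_sq_pos hβ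
  unfold gam
  positivity

/-- Shape over rate is the Gamma mean: this is the first of the two moment-matching equations. -/
lemma alpha_div_rate (hβi : 0 < beta σ k i) (hβ : 0 < ∑ l ∈ Finset.univ.erase i, beta σ k l) :
    alpha σ k i / (2 * gam σ k i)⁻¹ = ∑ l ∈ Finset.univ.erase i, beta σ k l / beta σ k i := by
  have := sum_beta_sq_pos hβ
  rw [← Finset.sum_div, alpha, gam]
  field_simp

/-- The second moment-matching equation; the factor `2` is the variance of a squared standard
normal. -/
lemma alpha_div_rate_sq (hβi : 0 < beta σ k i)
    (hβ : 0 < ∑ l ∈ Finset.univ.erase i, beta σ k l) :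
    alpha σ k i / (2 * gam σ k i)⁻¹ ^ 2 =
      ∑ l ∈ Finset.univ.erase i, (beta σ k l / beta σ k i) ^ 2 * 2 := by
  have := sum_beta_sq_pos hβ
  simp only [div_pow]
  rw [← Finset.sum_mul, ← Finset.sum_div, alpha, gam]
  field_simp

@[fun_prop]
lemma measurable_uVar (i : Fin d) : Measurable (uVar i) := by
  unfold uVar
  fun_prop

@[fun_prop]
lemma measurable_vVar (σ : Fin d → ℝ) (k : ℕ) (i : Fin d) : Measurable (vVar σ k i) := by
  unfold vVar
  fun_prop

lemma vVar_nonneg (σ : Fin d → ℝ) (k : ℕ) (i : Fin d) (y : Fin d → ℝ) : 0 ≤ vVar σ k i y :=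
  Finset.sum_nonneg fun l _ =>
    mul_nonneg (div_nonneg (beta_nonneg σ k l) (beta_nonneg σ k i)) (sq_nonneg _)

lemma hasLaw_uVar (i : Fin d) : HasLaw (uVar i) (gammaScale (1 / 2) 2) (stdNormal d) :=
  HasLaw.fun_comp (Y := fun x : ℝ => x ^ 2) ⟨by fun_prop, map_sq_gaussianReal⟩
    (measurePreserving_eval (fun _ : Fin d => gaussianReal 0 1) i).hasLaw

lemma iIndepFun_uVar : iIndepFun (fun l : Fin d => uVar l) (stdNormal d) :=
  iIndepFun_pi (μ := fun _ : Fin d => gaussianReal 0 1) (X := fun _ x => x ^ 2) fun _ => by fun_prop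

lemma vVar_eq_sum (σ : Fin d → ℝ) (k : ℕ) (i : Fin d) :
    vVar σ k i = ∑ l ∈ Finset.univ.erase i, (beta σ k l / beta σ k i) • uVar l := by
  ext y
  simp [vVar, uVar]

/-- The two variables depend on disjoint blocks of independent coordinates, `{i}` and its
complement. -/
lemma indepFun_uVar_vVar (σ : Fin d → ℝ) (k : ℕ) (i : Fin d) :
    IndepFun (uVar i) (vVar σ k i) (stdNormal d) := by
  have h := iIndepFun_uVar.indepFun_finset {i} (Finset.univ.erase i) (by simp) measurable_uVar
  have hφ : Measurable fun f : ({i} : Finset (Fin d)) → ℝ =>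
      f ⟨i, Finset.mem_singleton_self i⟩ :=
    measurable_pi_apply _
  have hψ : Measurable fun f : ↥(Finset.univ.erase i) → ℝ =>
      ∑ l : ↥(Finset.univ.erase i), beta σ k l / beta σ k i * f l := by fun_prop
  have hv : vVar σ k i = fun y => ∑ l : ↥(Finset.univ.erase i),
      beta σ k l / beta σ k i * uVar l y := by
    ext y
    exact (Finset.sum_coe_sort _ fun l => beta σ k l / beta σ k i * uVar l y).symm
  rw [hv]
  exact h.comp hφ hψ

lemma memLp_uVar (l : Fin d) : MemLp (uVar l) 2 (stdNormal d) := by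
  have h := memLp_id_gammaMeasure (a := 1 / 2) (r := 2⁻¹) (by norm_num) (by norm_num)
  rw [← gammaScale, ← (hasLaw_uVar l).map_eq] at h
  exact (memLp_map_measure_iff (by fun_prop) (by fun_prop)).1 h

lemma integral_uVar (l : Fin d) : ∫ y, uVar l y ∂stdNormal d = 1 := by
  rw [(hasLaw_uVar l).integral_eq, gammaScale,
    integral_id_gammaMeasure (by norm_num) (by norm_num)]
  norm_num

lemma variance_uVar (l : Fin d) : variance (uVar l) (stdNormal d) = 2 := by
  rw [(hasLaw_uVar l).variance_eq, gammaScale]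
  refine (variance_id_gammaMeasure (by norm_num) (by norm_num)).trans ?_
  norm_num

lemma memLp_vVar (σ : Fin d → ℝ) (k : ℕ) (i : Fin d) :
    MemLp (vVar σ k i) 2 (stdNormal d) := by
  rw [vVar_eq_sum]
  exact memLp_finsetSum' _ fun l _ => (memLp_uVar l).const_smul _

lemma integral_vVar (σ : Fin d → ℝ) (k : ℕ) (i : Fin d) :
    ∫ y, vVar σ k i y ∂stdNormal d =
      ∑ l ∈ Finset.univ.erase i, beta σ k l / beta σ k i := by
  unfold vVar
  rw [integral_finsetSum]
  · refine Finset.sum_congr rfl fun l _ => ?_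
    rw [integral_const_mul]
    exact (congrArg _ (integral_uVar l)).trans (mul_one _)
  · exact fun l _ => ((memLp_uVar l).integrable one_le_two).const_mul _

lemma variance_vVar (σ : Fin d → ℝ) (k : ℕ) (i : Fin d) :
    variance (vVar σ k i) (stdNormal d) =
      ∑ l ∈ Finset.univ.erase i, (beta σ k l / beta σ k i) ^ 2 * 2 := by
  rw [vVar_eq_sum, IndepFun.variance_sum]
  · exact Finset.sum_congr rfl fun l _ => by rw [variance_smul, variance_uVar]
  · exact fun l _ => (memLp_uVar l).const_smul _
  · intro l _ m _ hlm
    exact (iIndepFun_uVar.indepFun hlm).comp (φ := fun x => beta σ k l / beta σ k i * x)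
      (ψ := fun x => beta σ k m / beta σ k i * x) (by fun_prop) (by fun_prop)

lemma lam_eq_integral_beta (σ : Fin d → ℝ) (k : ℕ) (i : Fin d) :
    lam σ k i = ∫ y, beta σ k i * y i ^ 2 / (beta σ k i * y i ^ 2 +
      ∑ l ∈ Finset.univ.erase i, beta σ k l * y l ^ 2) ∂stdNormal d := by
  unfold lam
  congr 1 with y
  rw [Finset.add_sum_erase _ (fun l => beta σ k l * y l ^ 2) (Finset.mem_univ i)]
  simp only [beta, mul_pow, mul_comm]

lemma lam_eq_integral_div (hβi : 0 < beta σ k i) :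
    lam σ k i = ∫ y, uVar i y / (uVar i y + vVar σ k i y) ∂stdNormal d := by
  rw [lam_eq_integral_beta]
  congr 1 with y
  have h : ∑ l ∈ Finset.univ.erase i, beta σ k l * y l ^ 2 = beta σ k i * vVar σ k i y := by
    rw [vVar, Finset.mul_sum]
    refine Finset.sum_congr rfl fun l _ => ?_
    field_simp
  rw [h, ← mul_add, mul_div_mul_left _ _ hβi.ne', uVar]

end SpectralAug

theorem proposition2 {d : ℕ} (σ : Fin d → ℝ) (k : ℕ) (i : Fin d)
    (hβi : 0 < SpectralAug.beta σ k i)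
    (hβ : 0 < ∑ l ∈ Finset.univ.erase i, SpectralAug.beta σ k l) :
    -- the parameters are admissible
    0 < SpectralAug.alpha σ k i ∧ 0 < SpectralAug.gam σ k i ∧
    -- the expected value is that of `u / (u + vᵢ)`, exactly
    SpectralAug.lam σ k i =
      ∫ y, SpectralAug.beta σ k i * y i ^ 2 / (SpectralAug.beta σ k i * y i ^ 2 +
        ∑ l ∈ Finset.univ.erase i, SpectralAug.beta σ k l * y l ^ 2) ∂SpectralAug.stdNormal d ∧
    SpectralAug.lam σ k i =
      ∫ y, SpectralAug.uVar i y / (SpectralAug.uVar i y + SpectralAug.vVar σ k i y)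
        ∂SpectralAug.stdNormal d ∧
    Integrable (fun y => SpectralAug.uVar i y /
      (SpectralAug.uVar i y + SpectralAug.vVar σ k i y)) (SpectralAug.stdNormal d) ∧
    -- `u` has law `Gamma(1/2, 2)` and is independent of `vᵢ`
    HasLaw (SpectralAug.uVar i) (SpectralAug.gammaScale (1 / 2) 2) (SpectralAug.stdNormal d) ∧
    IndepFun (SpectralAug.uVar i) (SpectralAug.vVar σ k i) (SpectralAug.stdNormal d) ∧
    -- `Gamma(αᵢ, 2γᵢ)` has the same mean and variance as `vᵢ`
    MemLp (SpectralAug.vVar σ k i) 2 (SpectralAug.stdNormal d) ∧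
    MemLp (fun t : ℝ => t) 2
      (SpectralAug.gammaScale (SpectralAug.alpha σ k i) (2 * SpectralAug.gam σ k i)) ∧
    ∫ y, SpectralAug.vVar σ k i y ∂SpectralAug.stdNormal d =
      ∫ t, t ∂SpectralAug.gammaScale (SpectralAug.alpha σ k i) (2 * SpectralAug.gam σ k i) ∧
    variance (SpectralAug.vVar σ k i) (SpectralAug.stdNormal d) =
      variance (fun t : ℝ => t)
        (SpectralAug.gammaScale (SpectralAug.alpha σ k i) (2 * SpectralAug.gam σ k i)) ∧
    -- with `vᵢ` replaced by a `Gamma(αᵢ, 2γᵢ)` variable: density and expectation of `u / (u + vᵢ)`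
    (∀ {Ω : Type*} [MeasurableSpace Ω] (P : Measure Ω) [IsProbabilityMeasure P] (U V : Ω → ℝ),
      HasLaw U (SpectralAug.gammaScale (1 / 2) 2) P →
      HasLaw V
        (SpectralAug.gammaScale (SpectralAug.alpha σ k i) (2 * SpectralAug.gam σ k i)) P →
      IndepFun U V P →
      HasLaw (fun ω => U ω / (U ω + V ω))
        (volume.withDensity fun z => ENNReal.ofReal
          (SpectralAug.xPDF (SpectralAug.alpha σ k i) (SpectralAug.gam σ k i) z)) P ∧
      Integrable (fun ω => U ω / (U ω + V ω)) P ∧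
      ∫ ω, U ω / (U ω + V ω) ∂P =
        ∫ z in (0 : ℝ)..1,
          z * SpectralAug.xPDF (SpectralAug.alpha σ k i) (SpectralAug.gam σ k i) z) ∧
    -- the density is nonnegative and has support `[0, 1]`
    (∀ z, 0 ≤ SpectralAug.xPDF (SpectralAug.alpha σ k i) (SpectralAug.gam σ k i) z) ∧
    tsupport (SpectralAug.xPDF (SpectralAug.alpha σ k i) (SpectralAug.gam σ k i)) = Icc 0 1 ∧
    -- the closed form
    IntervalIntegrable
      (fun z => z * SpectralAug.xPDF (SpectralAug.alpha σ k i) (SpectralAug.gam σ k i) z)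
      volume 0 1 ∧
    ((∫ z in (0 : ℝ)..1,
        z * SpectralAug.xPDF (SpectralAug.alpha σ k i) (SpectralAug.gam σ k i) z : ℝ) : ℂ) =
      ((SpectralAug.gam σ k i ^ (1 / 2 : ℝ) *
        (Real.Gamma (3 / 2) * Real.Gamma (1 / 2 + SpectralAug.alpha σ k i) /
          (Real.Gamma (1 / 2) * Real.Gamma (3 / 2 + SpectralAug.alpha σ k i))) : ℝ) : ℂ) *
        SpectralAug.hyp2F1 (3 / 2) (1 / 2 + SpectralAug.alpha σ k i)
          (3 / 2 + SpectralAug.alpha σ k i) (1 - SpectralAug.gam σ k i) ∧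
    -- if `vᵢ` itself has the Gamma law, then the formula gives `λᵢ(k)`
    (HasLaw (SpectralAug.vVar σ k i)
        (SpectralAug.gammaScale (SpectralAug.alpha σ k i) (2 * SpectralAug.gam σ k i))
        (SpectralAug.stdNormal d) →
      SpectralAug.lam σ k i =
        ∫ z in (0 : ℝ)..1,
          z * SpectralAug.xPDF (SpectralAug.alpha σ k i) (SpectralAug.gam σ k i) z) := by
  have hα := SpectralAug.alpha_pos hβ
  have hγ := SpectralAug.gam_pos hβi hβ
  have hU := SpectralAug.hasLaw_uVar i
  have hind := SpectralAug.indepFun_uVar_vVar σ k i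
  have hint : Integrable (fun y => SpectralAug.uVar i y /
      (SpectralAug.uVar i y + SpectralAug.vVar σ k i y)) (SpectralAug.stdNormal d) :=
    SpectralAug.integrable_div_add (by fun_prop) (by fun_prop)
      (ae_of_all _ fun y => sq_nonneg (y i))
      (ae_of_all _ (SpectralAug.vVar_nonneg σ k i))
  refine ⟨hα, hγ, SpectralAug.lam_eq_integral_beta σ k i, SpectralAug.lam_eq_integral_div hβi, hint,
    hU, hind, SpectralAug.memLp_vVar σ k i,
    SpectralAug.memLp_id_gammaMeasure hα (by positivity), ?_, ?_, ?_,
    SpectralAug.xPDF_nonneg hα hγ, SpectralAug.tsupport_xPDF hα hγ,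
    SpectralAug.integrable_mul_xPDF hα hγ, SpectralAug.integral_mul_xPDF hα hγ, ?_⟩
  · rw [SpectralAug.integral_vVar, SpectralAug.gammaScale,
      SpectralAug.integral_id_gammaMeasure hα (by positivity),
      SpectralAug.alpha_div_rate hβi hβ]
  · rw [SpectralAug.variance_vVar, SpectralAug.gammaScale,
      SpectralAug.variance_id_gammaMeasure hα (by positivity),
      SpectralAug.alpha_div_rate_sq hβi hβ]
  · intro Ω _ P _ U V hU hV hUV
    exact ⟨SpectralAug.hasLaw_div_add hα hγ hU hV hUV,
      SpectralAug.integrable_div_add hU.aemeasurable hV.aemeasurable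
        (SpectralAug.HasLaw.ae_nonneg_of_gammaScale hU)
        (SpectralAug.HasLaw.ae_nonneg_of_gammaScale hV),
      SpectralAug.integral_div_add hα hγ hU hV hUV⟩
  · intro hV
    -- Here `uVar i` and `vVar σ k i` themselves serve as `U` and `V`, on the space `stdNormal d`.
    rw [SpectralAug.lam_eq_integral_div hβi, SpectralAug.integral_div_add hα hγ hU hV hind]
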